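/- A semi-strict stack of size $n$ is a finite sequence of positive integers $a_1,\dots,a_r,c,b_s,b_{s-1},\dots,b_1$ (with $r,s\ge 0$) whose sum is $n$ and which satisfies $$1\le a_1<a_2<\dots<a_r<c \qquad\text{and}\qquad c>b_s\ge b_{s-1}\ge\dots\ge b_1\ge 1 .$$ Let $dm(n)$ denote the number of semi-strict stacks of size $n$. Then, as $n\to\infty$, $$dm(n)\sim\frac{1}{16n}\,e^{\pi\sqrt n}.$$ -/

import Mathlib

/-- A sequence of integers is a semi-strict stack shape if it can be written as
`a₁, …, a_r, c, b_s, …, b₁` with `a₁ < a₂ < ⋯ < a_r < c` and `c > b_s ≥ b_{s-1} ≥ ⋯ ≥ b₁`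
(either side of the summit `c` may be empty). Below, `a` is the list `[a₁, …, a_r]` and `b` is
the list `[b_s, …, b₁]`, in the order in which they are written. -/
def IsSemiStrictStack (l : List ℕ) : Prop :=
  ∃ (a : List ℕ) (c : ℕ) (b : List ℕ), l = a ++ c :: b ∧
    (a ++ [c]).Pairwise (· < ·) ∧ (∀ x ∈ b, x < c) ∧ b.Pairwise (· ≥ ·)

/-- `dm n` is the number of semi-strict stacks of size `n`, that is, of sequences of positive
integers with sum `n` (`Composition n`) that are semi-strict stacks. -/
noncomputable def dm (n : ℕ) : ℕ :=
  Nat.card {s : Composition n // IsSemiStrictStack s.blocks}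

/-!
A stack with summit `c` consists of a set of positive integers below `c` (the strict slope) and a
multiset of positive integers below `c` (the weak slope), so that stacks have the generating function
`∑ q ^ c * P (c - 1)`, where `P m = ∏_{k ≤ m} (1 + q ^ k) / (1 - q ^ k)`. This sum telescopes: it is
`q / (1 + q)` times `F = lim P`, the generating function of overpartitions. Hence
`dm n + dm (n + 1)` is the coefficient `overCount n` of `q ^ n` in `F`
(`hasSum_overCount_and_tendsto`). Raising the summit by one shows that `dm` is monotone (`dm_mono`),
so that `dm n ≤ overCount n / 2 ≤ dm (n + 1)`, and it suffices to show that
`overCount n ∼ exp (π √n) / (8 n)` (`tendsto_overCount`).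

By Gauss's identity, `1 / F = ∑ (-1) ^ n q ^ (n ^ 2)` over all integers `n`; it follows from an
identity for finite sums whose terms telescope (`shanks_identity`). Poisson summation then gives
`F (exp (-z)) = (z / π) ^ (1 / 2) * exp (π ^ 2 / (4 z)) / (2 E)`, where `E` tends to `1` as
`Re (1 / z) → ∞` (`overGF_exp_neg`).

The coefficient is an integral over a circle of radius `exp (-t)`. The exponent `π ^ 2 / (4 t) + n t`
is least at `t = π / (2 √n)`, where it equals `π √n`. With `s ^ 2 = n t` and the angle `t v / s`, the
normalised integrand `circleKernel s v` tends to `exp (-v ^ 2)`, and it is dominated by a multiple of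
`1 / (1 + v ^ 2)`: for `|v| ≤ s` by the transformation formula, and elsewhere because each factor
of the product is smaller than at the positive real point of the circle (`norm_overGF_le`).
Dominated convergence yields the asymptotic formula.
-/

open Filter Topology MeasureTheory

/-! ### Stacks and their generating function -/

lemma HasSum.mul_complex {α β : Type*} {f : α → ℂ} {g : β → ℂ} {s t : ℂ} (hf : HasSum f s)
    (hg : HasSum g t) : HasSum (fun p : α × β => f p.1 * g p.2) (s * t) :=
  HasSum.mul hf hg (summable_mul_of_summable_norm (f := f) (g := g) hf.summable.norm
    hg.summable.norm)

/-- Strictly increasing lists of positive integers that are at most `m`: the possible left slopes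
of a semi-strict stack with summit `m + 1`. -/
def strictLists (m : ℕ) : Set (List ℕ) :=
  {a | a.Pairwise (· < ·) ∧ ∀ x ∈ a, 0 < x ∧ x ≤ m}

/-- Weakly decreasing lists of positive integers that are at most `m`: the possible right slopes
of a semi-strict stack with summit `m + 1`. -/
def weakLists (m : ℕ) : Set (List ℕ) :=
  {b | b.Pairwise (· ≥ ·) ∧ ∀ x ∈ b, 0 < x ∧ x ≤ m}

lemma strictLists_zero : strictLists 0 = {[]} := by
  ext a
  simp only [strictLists, Set.mem_ofPred_eq, Set.mem_singleton_iff]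
  constructor
  · rintro ⟨-, h⟩
    refine List.eq_nil_iff_forall_not_mem.2 fun x hx => ?_
    have := h x hx
    omega
  · rintro rfl
    simp

lemma weakLists_zero : weakLists 0 = {[]} := by
  ext a
  simp only [weakLists, Set.mem_ofPred_eq, Set.mem_singleton_iff]
  constructor
  · rintro ⟨-, h⟩
    refine List.eq_nil_iff_forall_not_mem.2 fun x hx => ?_
    have := h x hx
    omega
  · rintro rfl
    simp

lemma mem_strictLists_succ {m : ℕ} {l : List ℕ} :
    l ∈ strictLists (m + 1) ↔
      l ∈ strictLists m ∨ ∃ a ∈ strictLists m, l = a ++ [m + 1] := by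
  constructor
  · rintro ⟨h1, h2⟩
    rcases List.eq_nil_or_concat l with rfl | ⟨a, x, rfl⟩
    · left; simp [strictLists]
    · simp only [List.concat_eq_append] at *
      rw [List.pairwise_append] at h1
      obtain ⟨h1a, -, h1b⟩ := h1
      have hx := h2 x (by simp)
      by_cases hxm : x = m + 1
      · subst hxm
        refine Or.inr ⟨a, ⟨h1a, fun y hy => ?_⟩, rfl⟩
        have := h1b y hy (m + 1) (by simp)
        have := h2 y (by simp [hy])
        omega
      · refine Or.inl ⟨?_, fun y hy => ?_⟩
        · rw [List.pairwise_append]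
          exact ⟨h1a, by simp, h1b⟩
        · have := h2 y hy
          rw [List.mem_append, List.mem_singleton] at hy
          rcases hy with hy | rfl
          · have := h1b y hy x (by simp)
            omega
          · omega
  · rintro (⟨h1, h2⟩ | ⟨a, ⟨h1, h2⟩, rfl⟩)
    · refine ⟨h1, fun x hx => ?_⟩
      have := h2 x hx
      omega
    · refine ⟨?_, fun x hx => ?_⟩
      · rw [List.pairwise_append]
        refine ⟨h1, by simp, fun x hx y hy => ?_⟩
        have := h2 x hx
        simp only [List.mem_singleton] at hy
        omega
      · rw [List.mem_append, List.mem_singleton] at hx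
        rcases hx with hx | rfl
        · have := h2 x hx
          omega
        · omega

lemma exists_replicate_of_mem_weakLists_succ {m : ℕ} :
    ∀ {l : List ℕ}, l ∈ weakLists (m + 1) →
      ∃ j, ∃ b ∈ weakLists m, l = List.replicate j (m + 1) ++ b
  | [], _ => ⟨0, [], by simp [weakLists], by simp⟩
  | x :: l, ⟨h1, h2⟩ => by
    rw [List.pairwise_cons] at h1
    have hx := h2 x (by simp)
    by_cases hxm : x = m + 1
    · obtain ⟨j, b, hb, hl⟩ := exists_replicate_of_mem_weakLists_succ (m := m) (l := l)
        ⟨h1.2, fun y hy => h2 y (by simp [hy])⟩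
      exact ⟨j + 1, b, hb, by rw [hl, hxm]; simp [List.replicate_succ]⟩
    · refine ⟨0, x :: l, ⟨List.pairwise_cons.2 h1, fun y hy => ?_⟩, by simp⟩
      have h3 := h2 y hy
      rw [List.mem_cons] at hy
      rcases hy with rfl | hy
      · omega
      · have := h1.1 y hy
        omega

lemma replicate_append_mem_weakLists {m : ℕ} (j : ℕ) {b : List ℕ} (hb : b ∈ weakLists m) :
    List.replicate j (m + 1) ++ b ∈ weakLists (m + 1) := by
  refine ⟨?_, fun x hx => ?_⟩
  · rw [List.pairwise_append]
    refine ⟨?_, hb.1, fun x hx y hy => ?_⟩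
    · rw [List.pairwise_replicate]
      right; exact le_rfl
    · have := hb.2 y hy
      rw [List.eq_of_mem_replicate hx]
      omega
  · rw [List.mem_append] at hx
    rcases hx with hx | hx
    · rw [List.eq_of_mem_replicate hx]
      omega
    · have := hb.2 x hx
      omega

lemma replicate_append_injOn {m : ℕ} {j k : ℕ} {b c : List ℕ} (hb : b ∈ weakLists m)
    (hc : c ∈ weakLists m)
    (h : List.replicate j (m + 1) ++ b = List.replicate k (m + 1) ++ c) : j = k ∧ b = c := by
  have h0 : ∀ {d : List ℕ}, d ∈ weakLists m → d.count (m + 1) = 0 := fun {d} hd =>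
    List.count_eq_zero.2 fun hx => by have := hd.2 _ hx; omega
  have hjk : j = k := by
    have := congrArg (List.count (m + 1)) h
    simpa [h0 hb, h0 hc] using this
  subst hjk
  exact ⟨rfl, List.append_cancel_left h⟩

lemma hasSum_strictLists (q : ℂ) (m : ℕ) :
    HasSum (fun a : strictLists m => q ^ (a : List ℕ).sum)
      (∏ k ∈ Finset.range m, (1 + q ^ (k + 1))) := by
  induction m with
  | zero =>
    rw [strictLists_zero]
    convert hasSum_unique (fun a : ({[]} : Set (List ℕ)) => q ^ (a : List ℕ).sum) using 1
    simp
  | succ m ih =>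
    have hinj : Function.Injective (fun a : List ℕ => a ++ [m + 1]) :=
      fun a b h => List.append_cancel_right h
    have hset : strictLists (m + 1) =
        strictLists m ∪ (fun a : List ℕ => a ++ [m + 1]) '' strictLists m := by
      ext l
      rw [mem_strictLists_succ]
      simp [eq_comm]
    have hdisj : Disjoint (strictLists m)
        ((fun a : List ℕ => a ++ [m + 1]) '' strictLists m) := by
      rw [Set.disjoint_left]
      rintro _ h ⟨a, -, rfl⟩
      have := h.2 (m + 1) (by simp)
      omega
    have h2 : HasSum (fun a : ((fun a : List ℕ => a ++ [m + 1]) '' strictLists m) =>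
        q ^ (a : List ℕ).sum) ((∏ k ∈ Finset.range m, (1 + q ^ (k + 1))) * q ^ (m + 1)) := by
      rw [← (Equiv.Set.image _ (strictLists m) hinj).hasSum_iff]
      refine (ih.mul_right (q ^ (m + 1))).congr_fun fun a => ?_
      change q ^ ((a : List ℕ) ++ [m + 1]).sum = _
      rw [List.sum_append, pow_add, List.sum_singleton]
    rw [hset, Finset.prod_range_succ, mul_add, mul_one]
    exact HasSum.add_disjoint (f := fun l : List ℕ => q ^ l.sum) hdisj ih h2

lemma hasSum_weakLists {q : ℂ} (hq : ‖q‖ < 1) (m : ℕ) :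
    HasSum (fun b : weakLists m => q ^ (b : List ℕ).sum)
      (∏ k ∈ Finset.range m, (1 - q ^ (k + 1))⁻¹) := by
  induction m with
  | zero =>
    rw [weakLists_zero]
    convert hasSum_unique (fun a : ({[]} : Set (List ℕ)) => q ^ (a : List ℕ).sum) using 1
    simp
  | succ m ih =>
    -- A list with entries up to `m + 1` starts with some number of copies of `m + 1`.
    let e : weakLists m × ℕ → weakLists (m + 1) := fun p =>
      ⟨List.replicate p.2 (m + 1) ++ p.1, replicate_append_mem_weakLists p.2 p.1.2⟩
    have he : Function.Bijective e := by
      constructor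
      · rintro ⟨⟨b, hb⟩, j⟩ ⟨⟨c, hc⟩, k⟩ h
        obtain ⟨rfl, rfl⟩ := replicate_append_injOn hb hc (congrArg Subtype.val h)
        rfl
      · rintro ⟨l, hl⟩
        obtain ⟨j, b, hb, rfl⟩ := exists_replicate_of_mem_weakLists_succ hl
        exact ⟨(⟨b, hb⟩, j), rfl⟩
    rw [← (Equiv.ofBijective e he).hasSum_iff, Finset.prod_range_succ]
    have hg : HasSum (fun j : ℕ => (q ^ (m + 1)) ^ j) (1 - q ^ (m + 1))⁻¹ := by
      apply hasSum_geometric_of_norm_lt_one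
      rw [norm_pow]
      exact pow_lt_one₀ (norm_nonneg _) hq (by omega)
    refine (ih.mul_complex hg).congr_fun fun p => ?_
    change q ^ (List.replicate p.2 (m + 1) ++ (p.1 : List ℕ)).sum = _
    rw [List.sum_append, List.sum_replicate, smul_eq_mul, pow_add, ← pow_mul]
    ring

lemma exists_decomposition_of_isSemiStrictStack {l : List ℕ} (hl : IsSemiStrictStack l)
    (hpos : ∀ x ∈ l, 0 < x) :
    ∃ m, ∃ a ∈ strictLists m, ∃ b ∈ weakLists m, l = a ++ (m + 1) :: b := by
  obtain ⟨a, c, b, rfl, h1, h2, h3⟩ := hl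
  have hc : 0 < c := hpos c (by simp)
  obtain ⟨m, rfl⟩ : ∃ m, c = m + 1 := ⟨c - 1, by omega⟩
  rw [List.pairwise_append] at h1
  refine ⟨m, a, ⟨h1.1, fun x hx => ⟨hpos x (by simp [hx]), ?_⟩⟩, b,
    ⟨h3, fun x hx => ⟨hpos x (by simp [hx]), ?_⟩⟩, rfl⟩
  · have := h1.2.2 x hx (m + 1) (by simp)
    omega
  · have := h2 x hx
    omega

lemma isSemiStrictStack_of_mem {m : ℕ} {a b : List ℕ} (ha : a ∈ strictLists m)
    (hb : b ∈ weakLists m) : IsSemiStrictStack (a ++ (m + 1) :: b) := by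
  refine ⟨a, m + 1, b, rfl, ?_, fun x hx => ?_, hb.1⟩
  · rw [List.pairwise_append]
    refine ⟨ha.1, by simp, fun x hx y hy => ?_⟩
    have := ha.2 x hx
    simp only [List.mem_singleton] at hy
    omega
  · have := hb.2 x hx
    omega

/-- The summit is the only maximal entry of a stack, so that it determines the decomposition. -/
lemma decomposition_unique {m m' : ℕ} {a b a' b' : List ℕ} (ha : a ∈ strictLists m)
    (hb : b ∈ weakLists m) (ha' : a' ∈ strictLists m') (hb' : b' ∈ weakLists m')
    (h : a ++ (m + 1) :: b = a' ++ (m' + 1) :: b') : a = a' ∧ m = m' ∧ b = b' := by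
  wlog hm : m ≤ m' generalizing m m' a a' b b'
  · obtain ⟨rfl, rfl, rfl⟩ := this ha' hb' ha hb h.symm (by omega)
    exact ⟨rfl, rfl, rfl⟩
  have := (List.append_cons_inj_of_notMem
    (fun hx => by have := ha.2 _ hx; omega) (fun hx => by have := hb.2 _ hx; omega)).1 h
  exact ⟨this.1, by omega, this.2.2⟩

/-- Semi-strict stacks of all sizes, encoded by the summit `m + 1` and the two slopes. -/
abbrev StackData : Type := Σ m : ℕ, strictLists m × weakLists m

/-- The stack with given summit and slopes. -/
def StackData.toStack (s : StackData) :
    Σ n : ℕ, {c : Composition n // IsSemiStrictStack c.blocks} :=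
  ⟨((s.2.1 : List ℕ) ++ (s.1 + 1) :: (s.2.2 : List ℕ)).sum,
    ⟨⟨(s.2.1 : List ℕ) ++ (s.1 + 1) :: (s.2.2 : List ℕ), by
      intro i hi
      rw [List.mem_append, List.mem_cons] at hi
      rcases hi with hi | rfl | hi
      · exact (s.2.1.2.2 i hi).1
      · omega
      · exact (s.2.2.2.2 i hi).1, rfl⟩,
    isSemiStrictStack_of_mem s.2.1.2 s.2.2.2⟩⟩

lemma StackData.toStack_bijective : Function.Bijective StackData.toStack := by
  constructor
  · rintro ⟨m, ⟨a, ha⟩, ⟨b, hb⟩⟩ ⟨m', ⟨a', ha'⟩, ⟨b', hb'⟩⟩ h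
    have h' := congrArg (fun s : Σ n : ℕ, {c : Composition n // IsSemiStrictStack c.blocks} =>
      s.2.1.blocks) h
    obtain ⟨rfl, rfl, rfl⟩ := decomposition_unique ha hb ha' hb' h'
    rfl
  · rintro ⟨n, ⟨⟨l, hpos, rfl⟩, hl⟩⟩
    obtain ⟨m, a, ha, b, hb, rfl⟩ :=
      exists_decomposition_of_isSemiStrictStack hl (fun x hx => hpos hx)
    exact ⟨⟨m, ⟨a, ha⟩, ⟨b, hb⟩⟩, rfl⟩

/-- The partial product `∏_{k ≤ m} (1 + q ^ k) / (1 - q ^ k)` of the generating function of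
overpartitions. -/
noncomputable def overProd {K : Type*} [Field K] (q : K) (m : ℕ) : K :=
  ∏ k ∈ Finset.range m, (1 + q ^ (k + 1)) / (1 - q ^ (k + 1))

lemma overProd_zero {K : Type*} [Field K] (q : K) : overProd q 0 = 1 := by
  simp [overProd]

lemma overProd_succ {K : Type*} [Field K] (q : K) (m : ℕ) :
    overProd q (m + 1) = overProd q m * ((1 + q ^ (m + 1)) / (1 - q ^ (m + 1))) :=
  Finset.prod_range_succ _ _

/-- Stacks with summit `m + 1` have the generating function `q ^ (m + 1) * overProd q m`. -/
lemma hasSum_fixed_summit {q : ℂ} (hq : ‖q‖ < 1) (m : ℕ) :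
    HasSum (fun s : strictLists m × weakLists m =>
        q ^ ((s.1 : List ℕ) ++ (m + 1) :: (s.2 : List ℕ)).sum)
      (q ^ (m + 1) * overProd q m) := by
  have h1 := hasSum_strictLists q m
  have h2 := hasSum_weakLists hq m
  have h3 := (h1.mul_complex h2).mul_left (q ^ (m + 1))
  rw [← Finset.prod_mul_distrib] at h3
  simp only [← div_eq_mul_inv] at h3
  refine h3.congr_fun fun s => ?_
  rw [List.sum_append, List.sum_cons, pow_add, pow_add]
  ring

/-- A stack becomes one of the next size when its summit is raised by one. -/
lemma dm_mono (n : ℕ) : dm n ≤ dm (n + 1) := by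
  have key : ∀ s : {c : Composition n // IsSemiStrictStack c.blocks},
      ∃ d : StackData, d.toStack = ⟨n, s⟩ := fun s => StackData.toStack_bijective.2 ⟨n, s⟩
  choose d hd using key
  have hlen : ∀ s, ((d s).2.1 : List ℕ).sum + (d s).1 + 1 + ((d s).2.2 : List ℕ).sum = n := by
    intro s
    have := congrArg Sigma.fst (hd s)
    simp only [StackData.toStack, List.sum_append, List.sum_cons] at this
    omega
  have hs : ∀ m, strictLists m ⊆ strictLists (m + 1) := fun m a ha =>
    ⟨ha.1, fun x hx => by have := ha.2 x hx; omega⟩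
  have hw : ∀ m, weakLists m ⊆ weakLists (m + 1) := fun m a ha =>
    ⟨ha.1, fun x hx => by have := ha.2 x hx; omega⟩
  refine Nat.card_le_card_of_injective (fun s =>
    (⟨⟨((d s).2.1 : List ℕ) ++ ((d s).1 + 2) :: ((d s).2.2 : List ℕ), ?_, ?_⟩,
      isSemiStrictStack_of_mem (hs _ (d s).2.1.2) (hw _ (d s).2.2.2)⟩ :
        {c : Composition (n + 1) // IsSemiStrictStack c.blocks})) ?_
  · intro i hi
    rw [List.mem_append, List.mem_cons] at hi
    rcases hi with hi | rfl | hi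
    · exact ((d s).2.1.2.2 i hi).1
    · omega
    · exact ((d s).2.2.2.2 i hi).1
  · have := hlen s
    rw [List.sum_append, List.sum_cons]
    omega
  · intro s s' h
    have h' := congrArg (fun s : {c : Composition (n + 1) // IsSemiStrictStack c.blocks} =>
      s.1.blocks) h
    obtain ⟨h1, h2, h3⟩ := decomposition_unique (hs _ (d s).2.1.2) (hw _ (d s).2.2.2)
      (hs _ (d s').2.1.2) (hw _ (d s').2.2.2) h'
    have hdd : (d s).toStack.2.1.blocks = (d s').toStack.2.1.blocks := by
      simp only [StackData.toStack]
      rw [h1, h3, Nat.succ_injective h2]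
    rw [hd s, hd s'] at hdd
    exact Subtype.ext (Composition.ext hdd)

lemma dm_zero : dm 0 = 0 := by
  rw [dm, Nat.card_eq_zero]
  left
  refine ⟨fun ⟨s, a, c, b, h, _⟩ => ?_⟩
  have h1 := s.blocks_pos (i := c) (by rw [h]; simp)
  have h2 := s.blocks_sum
  rw [h, List.sum_append, List.sum_cons] at h2
  omega

/-- Sorting the stacks by their sizes instead of by their summits. -/
lemma hasSum_dm {q D : ℂ} (hq : ‖q‖ < 1)
    (hs : Summable fun m : ℕ => ‖q‖ ^ (m + 1) * overProd ‖q‖ m)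
    (hD : HasSum (fun m : ℕ => q ^ (m + 1) * overProd q m) D) :
    HasSum (fun n : ℕ => (dm n : ℂ) * q ^ n) D := by
  have hfib : ∀ p : ℂ, ‖p‖ < 1 → ∀ m, HasSum (fun s : strictLists m × weakLists m =>
      p ^ (StackData.toStack ⟨m, s⟩).1) (p ^ (m + 1) * overProd p m) := fun p hp m =>
    hasSum_fixed_summit hp m
  have hsum : Summable fun s : StackData => q ^ s.toStack.1 := by
    refine Summable.of_norm ?_
    have hn : ∀ m, HasSum (fun s : strictLists m × weakLists m =>
        ‖q ^ (StackData.toStack ⟨m, s⟩).1‖) (‖q‖ ^ (m + 1) * overProd ‖q‖ m) := by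
      intro m
      have := hfib (‖q‖ : ℂ) (by simpa using hq) m
      rw [← Complex.hasSum_ofReal]
      convert this using 1
      · funext s
        simp
      · simp [overProd]
    rw [summable_sigma_of_nonneg (fun _ => norm_nonneg _)]
    refine ⟨fun m => (hn m).summable, ?_⟩
    convert hs using 2 with m
    exact (hn m).tsum_eq
  have h1 : HasSum (fun s : StackData => q ^ s.toStack.1) D :=
    HasSum.sigma_of_hasSum hD (hfib q hq) hsum
  have h2 : HasSum (fun x : Σ n : ℕ, {c : Composition n // IsSemiStrictStack c.blocks} =>
      q ^ x.1) D :=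
    (Equiv.ofBijective _ StackData.toStack_bijective).hasSum_iff.1 h1
  refine h2.sigma fun n => ?_
  have : Fintype {c : Composition n // IsSemiStrictStack c.blocks} := Fintype.ofFinite _
  convert hasSum_fintype (fun _ : {c : Composition n // IsSemiStrictStack c.blocks} => q ^ n)
    using 1
  rw [Finset.sum_const, Finset.card_univ, dm, Nat.card_eq_fintype_card, nsmul_eq_mul]

/-! ### Telescoping and Gauss's identity -/

lemma one_sub_pow_ne_zero {q : ℂ} (hq : ‖q‖ < 1) (k : ℕ) : 1 - q ^ (k + 1) ≠ 0 := by
  intro h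
  have h1 : ‖q ^ (k + 1)‖ < 1 := by
    rw [norm_pow]
    exact pow_lt_one₀ (norm_nonneg _) hq (by omega)
  rw [← sub_eq_zero.1 h, norm_one] at h1
  exact lt_irrefl _ h1

lemma one_add_pow_ne_zero {q : ℂ} (hq : ‖q‖ < 1) (k : ℕ) : 1 + q ^ (k + 1) ≠ 0 := by
  intro h
  have h1 : ‖q ^ (k + 1)‖ < 1 := by
    rw [norm_pow]
    exact pow_lt_one₀ (norm_nonneg _) hq (by omega)
  rw [eq_neg_of_add_eq_zero_right h, norm_neg, norm_one] at h1
  exact lt_irrefl _ h1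

lemma overProd_ne_zero {q : ℂ} (hq : ‖q‖ < 1) (m : ℕ) : overProd q m ≠ 0 :=
  Finset.prod_ne_zero_iff.2 fun k _ =>
    div_ne_zero (one_add_pow_ne_zero hq k) (one_sub_pow_ne_zero hq k)

/-- The sum over the summits telescopes. -/
lemma one_add_mul_sum_overProd {q : ℂ} (hq : ‖q‖ < 1) (M : ℕ) :
    (1 + q) * ∑ m ∈ Finset.range M, q ^ (m + 1) * overProd q m =
      q * (1 - q ^ M) * overProd q M := by
  induction M with
  | zero => simp
  | succ M ih =>
    rw [Finset.sum_range_succ, mul_add, ih, overProd_succ]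
    have := one_sub_pow_ne_zero hq M
    field_simp
    ring

/-- A finite form of Gauss's identity
`∑ (-1) ^ n * q ^ (n ^ 2) = ∏ (1 - q ^ k) / (1 + q ^ k)`, in the manner of Shanks. -/
lemma shanks_identity {q : ℂ} (hq : ‖q‖ < 1) (n : ℕ) :
    1 + ∑ s ∈ Finset.range n, 2 * ((-1) ^ (s + 1) * q ^ ((s + 1) ^ 2)) =
      ∑ s ∈ Finset.range (n + 1),
        (-1) ^ s * (2 / (1 + q ^ s)) * (overProd q s / overProd q n) * q ^ (s * (n + 1)) := by
  induction n with
  | zero => simp [overProd_zero]; norm_num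
  | succ n ih =>
    have hn := overProd_ne_zero hq n
    have hx1 := one_add_pow_ne_zero hq n
    have hx2 := one_sub_pow_ne_zero hq n
    -- The differences of corresponding terms telescope in `s`.
    have tel : ∀ k, ∑ s ∈ Finset.range (k + 1),
        ((-1) ^ s * (2 / (1 + q ^ s)) * (overProd q s / overProd q (n + 1)) *
            q ^ (s * (n + 1 + 1)) -
          (-1) ^ s * (2 / (1 + q ^ s)) * (overProd q s / overProd q n) * q ^ (s * (n + 1))) =
        -((-1) ^ k * 2 * (overProd q k / overProd q n) * q ^ ((n + 1) * (k + 1)) /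
          (1 + q ^ (n + 1))) := by
      intro k
      induction k with
      | zero =>
        simp only [zero_add, Finset.sum_range_one, pow_zero, overProd_zero, overProd_succ, zero_mul,
          mul_one]
        field_simp
        ring
      | succ k ihk =>
        rw [Finset.sum_range_succ, ihk, overProd_succ, overProd_succ]
        have hk := overProd_ne_zero hq k
        have hy1 := one_add_pow_ne_zero hq k
        have hy2 := one_sub_pow_ne_zero hq k
        have e1 : q ^ ((k + 1) * (n + 1 + 1)) = q ^ ((n + 1) * (k + 1)) * q ^ (k + 1) := by
          rw [← pow_add]; congr 1; ring
        have e2 : q ^ ((n + 1) * (k + 1 + 1)) = q ^ ((n + 1) * (k + 1)) * q ^ (n + 1) := by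
          rw [← pow_add]; congr 1
        rw [e1, e2, mul_comm (k + 1) (n + 1), pow_succ (-1 : ℂ) k]
        generalize q ^ ((n + 1) * (k + 1)) = A
        generalize q ^ (k + 1) = y at *
        generalize q ^ (n + 1) = x at *
        generalize (-1 : ℂ) ^ k = ε
        field_simp
        ring
    have h1 := tel n
    rw [Finset.sum_sub_distrib, sub_eq_iff_eq_add] at h1
    rw [Finset.sum_range_succ _ (n + 1), h1, ← ih, Finset.sum_range_succ _ n]
    have hn' := overProd_ne_zero hq (n + 1)
    have e1 : q ^ ((n + 1) * (n + 1 + 1)) = q ^ ((n + 1) ^ 2) * q ^ (n + 1) := by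
      rw [← pow_add]; congr 1; ring
    rw [e1, ← sq, pow_succ (-1 : ℂ) n, div_self hn, div_self hn']
    field_simp
    ring

lemma exists_overProd_le {r : ℝ} (h0 : 0 ≤ r) (h1 : r < 1) : ∃ C, ∀ m, overProd r m ≤ C := by
  have hr : 0 < 1 - r := by linarith
  refine ⟨Real.exp (∑' k : ℕ, 2 / (1 - r) * r ^ k), fun m => ?_⟩
  have hs : Summable fun k : ℕ => 2 / (1 - r) * r ^ k :=
    (summable_geometric_of_lt_one h0 h1).mul_left _
  have hp : ∀ k : ℕ, r ^ (k + 1) ≤ r ^ k := fun k => pow_le_pow_of_le_one h0 h1.le (by omega)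
  have hp1 : ∀ k : ℕ, r ^ (k + 1) ≤ r := fun k => by
    simpa using pow_le_pow_of_le_one h0 h1.le (show 1 ≤ k + 1 by omega)
  calc overProd r m = ∏ k ∈ Finset.range m, (1 + 2 * r ^ (k + 1) / (1 - r ^ (k + 1))) := by
        refine Finset.prod_congr rfl fun k _ => ?_
        have : 1 - r ^ (k + 1) ≠ 0 := by linarith [hp1 k]
        field_simp
        ring
    _ ≤ ∏ k ∈ Finset.range m, (1 + 2 / (1 - r) * r ^ k) := by
        refine Finset.prod_le_prod (fun k _ => ?_) fun k _ => ?_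
        · have : 0 < 1 - r ^ (k + 1) := by linarith [hp1 k]
          positivity
        · rw [div_mul_eq_mul_div]
          exact add_le_add le_rfl (div_le_div₀ (by positivity)
            (mul_le_mul_of_nonneg_left (hp k) zero_le_two) hr (by linarith [hp1 k]))
    _ ≤ Real.exp (∑ k ∈ Finset.range m, 2 / (1 - r) * r ^ k) :=
        Real.prod_one_add_le_exp_sum _ fun k => by positivity
    _ ≤ _ := Real.exp_le_exp.2 (hs.sum_le_tsum _ fun k _ => by positivity)

lemma overProd_pos {r : ℝ} (h0 : 0 ≤ r) (h1 : r < 1) (m : ℕ) : 0 < overProd r m := by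
  refine Finset.prod_pos fun k _ => ?_
  have : r ^ (k + 1) < 1 := pow_lt_one₀ h0 h1 (by omega)
  have : 0 < 1 - r ^ (k + 1) := by linarith
  positivity

lemma norm_overProd_le {q : ℂ} (hq : ‖q‖ < 1) (m : ℕ) : ‖overProd q m‖ ≤ overProd ‖q‖ m := by
  rw [overProd, norm_prod]
  refine Finset.prod_le_prod (fun _ _ => norm_nonneg _) fun k _ => ?_
  rw [norm_div]
  have h : ‖q‖ ^ (k + 1) < 1 := pow_lt_one₀ (norm_nonneg _) hq (by omega)
  have h1 := norm_add_le 1 (q ^ (k + 1))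
  have h2 := norm_sub_norm_le 1 (q ^ (k + 1))
  rw [norm_one, norm_pow] at h1 h2
  gcongr

lemma norm_inv_overProd_le {q : ℂ} (hq : ‖q‖ < 1) (m : ℕ) :
    ‖(overProd q m)⁻¹‖ ≤ overProd ‖q‖ m := by
  rw [overProd, ← Finset.prod_inv_distrib, norm_prod]
  refine Finset.prod_le_prod (fun _ _ => norm_nonneg _) fun k _ => ?_
  rw [inv_div, norm_div]
  have h : ‖q‖ ^ (k + 1) < 1 := pow_lt_one₀ (norm_nonneg _) hq (by omega)
  have h1 := norm_sub_le 1 (q ^ (k + 1))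
  have h2 := norm_sub_norm_le 1 (-q ^ (k + 1))
  rw [norm_neg, sub_neg_eq_add] at h2
  rw [norm_one, norm_pow] at h1 h2
  gcongr

/-- Gauss's identity: the products converge to the reciprocal of the theta series. -/
lemma tendsto_inv_overProd {q : ℂ} (hq : ‖q‖ < 1) {θ : ℂ}
    (hθ : HasSum (fun s : ℕ => 2 * ((-1) ^ (s + 1) * q ^ ((s + 1) ^ 2))) (θ - 1)) :
    Tendsto (fun n => (overProd q n)⁻¹) atTop (𝓝 θ) := by
  obtain ⟨C, hC⟩ := exists_overProd_le (norm_nonneg q) hq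
  have hC0 : 0 ≤ C := (overProd_pos (norm_nonneg q) hq 0).le.trans (hC 0)
  have hr : 0 < 1 - ‖q‖ := by linarith
  have hlim : Tendsto (fun n => 1 + ∑ s ∈ Finset.range n, 2 * ((-1) ^ (s + 1) * q ^ ((s + 1) ^ 2)))
      atTop (𝓝 θ) := by
    simpa using hθ.tendsto_sum_nat.const_add 1
  -- In the finite identity, the terms with `s ≥ 1` are small.
  have hdiff : ∀ n, ‖(overProd q n)⁻¹ -
      (1 + ∑ s ∈ Finset.range n, 2 * ((-1) ^ (s + 1) * q ^ ((s + 1) ^ 2)))‖ ≤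
        2 / (1 - ‖q‖) * (C * C) * (1 - ‖q‖)⁻¹ * ‖q‖ ^ n := by
    intro n
    have e : (-1 : ℂ) ^ 0 * (2 / (1 + q ^ 0)) * (overProd q 0 / overProd q n) * q ^ (0 * (n + 1)) =
        (overProd q n)⁻¹ := by
      rw [overProd_zero]; norm_num
    rw [shanks_identity hq, Finset.sum_range_succ', e, sub_add_cancel_right, norm_neg]
    refine (norm_sum_le _ _).trans ?_
    have hterm : ∀ s ∈ Finset.range n, ‖(-1 : ℂ) ^ (s + 1) * (2 / (1 + q ^ (s + 1))) *
        (overProd q (s + 1) / overProd q n) * q ^ ((s + 1) * (n + 1))‖ ≤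
        2 / (1 - ‖q‖) * (C * C) * ‖q‖ ^ n * ‖q‖ ^ s := by
      intro s _
      have h2 := norm_sub_norm_le 1 (-q ^ (s + 1))
      rw [norm_neg, sub_neg_eq_add, norm_one, norm_pow] at h2
      have hp1 : ‖q‖ ^ (s + 1) ≤ ‖q‖ := by
        simpa using pow_le_pow_of_le_one (norm_nonneg q) hq.le (show 1 ≤ s + 1 by omega)
      rw [norm_mul, norm_mul, norm_mul, norm_pow, norm_neg, norm_one, one_pow, one_mul, norm_div,
        div_eq_mul_inv (overProd q (s + 1)), norm_mul, norm_pow, Complex.norm_ofNat,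
        mul_assoc _ (‖q‖ ^ n), ← pow_add]
      have hpp : ‖q‖ ^ ((s + 1) * (n + 1)) ≤ ‖q‖ ^ (n + s) :=
        pow_le_pow_of_le_one (norm_nonneg q) hq.le (by nlinarith)
      gcongr
      · linarith
      · exact (norm_overProd_le hq _).trans (hC _)
      · exact (norm_inv_overProd_le hq _).trans (hC _)
    refine (Finset.sum_le_sum hterm).trans ?_
    rw [← Finset.mul_sum]
    have hg := (summable_geometric_of_lt_one (norm_nonneg q) hq).sum_le_tsum (Finset.range n)
      fun k _ => by positivity
    rw [tsum_geometric_of_lt_one (norm_nonneg q) hq] at hg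
    calc _ ≤ 2 / (1 - ‖q‖) * (C * C) * ‖q‖ ^ n * (1 - ‖q‖)⁻¹ := by gcongr
      _ = _ := by ring
  have h0 : Tendsto (fun n => 2 / (1 - ‖q‖) * (C * C) * (1 - ‖q‖)⁻¹ * ‖q‖ ^ n) atTop (𝓝 0) := by
    simpa using (tendsto_pow_atTop_nhds_zero_of_lt_one (norm_nonneg q) hq).const_mul
      (2 / (1 - ‖q‖) * (C * C) * (1 - ‖q‖)⁻¹)
  simpa using (squeeze_zero_norm hdiff h0).add hlim

/-- The number of overpartitions of `n`, defined as `dm n + dm (n + 1)`; that it has the product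
generating function is `hasSum_overCount_and_tendsto`. -/
noncomputable def overCount (n : ℕ) : ℕ := dm n + dm (n + 1)

/-- The generating function of overpartitions. -/
noncomputable def overGF (q : ℂ) : ℂ := ∑' n : ℕ, (overCount n : ℂ) * q ^ n

/-- The generating function of overpartitions is the infinite product
`∏ (1 + q ^ k) / (1 - q ^ k)`. The value `q = 0` is left out because the sum over the stacks is
divided by `q`. -/
lemma hasSum_overCount_and_tendsto {q : ℂ} (hq : ‖q‖ < 1) (hq0 : q ≠ 0) :
    HasSum (fun n : ℕ => (overCount n : ℂ) * q ^ n) (overGF q) ∧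
      Tendsto (overProd q) atTop (𝓝 (overGF q)) := by
  obtain ⟨C, hC⟩ := exists_overProd_le (norm_nonneg q) hq
  have hs : Summable fun m : ℕ => ‖q‖ ^ (m + 1) * overProd ‖q‖ m := by
    refine Summable.of_nonneg_of_le (fun m => ?_) (fun m => ?_)
      ((summable_geometric_of_lt_one (norm_nonneg q) hq).mul_right C)
    · exact mul_nonneg (by positivity) (overProd_pos (norm_nonneg q) hq m).le
    · exact mul_le_mul (pow_le_pow_of_le_one (norm_nonneg q) hq.le (by omega)) (hC m)
        (overProd_pos (norm_nonneg q) hq m).le (by positivity)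
  have hsq : Summable fun m : ℕ => q ^ (m + 1) * overProd q m := by
    refine Summable.of_norm_bounded hs fun m => ?_
    rw [norm_mul, norm_pow]
    gcongr
    exact norm_overProd_le hq m
  obtain ⟨D, hD⟩ := hsq
  have h1 := hasSum_dm hq hs hD
  have h2 : HasSum (fun n : ℕ => (dm (n + 1) : ℂ) * q ^ n) (D / q) := by
    have h3 := (hasSum_nat_add_iff' 1).2 h1
    simp only [Finset.sum_range_one, dm_zero, Nat.cast_zero, zero_mul, sub_zero] at h3
    refine (h3.div_const q).congr_fun fun n => ?_
    field_simp
    ring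
  have h4 : HasSum (fun n : ℕ => (overCount n : ℂ) * q ^ n) (D + D / q) := by
    refine (h1.add h2).congr_fun fun n => ?_
    rw [overCount]
    push_cast
    ring
  rw [show overGF q = D + D / q from h4.tsum_eq]
  refine ⟨h4, ?_⟩
  have h5 : Tendsto (fun M => (1 + q) * (∑ m ∈ Finset.range M, q ^ (m + 1) * overProd q m) /
      (q * (1 - q ^ M))) atTop (𝓝 ((1 + q) * D / (q * (1 - 0)))) := by
    refine (hD.tendsto_sum_nat.const_mul (1 + q)).div
      (((tendsto_pow_atTop_nhds_zero_of_norm_lt_one hq).const_sub 1).const_mul q) ?_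
    simpa using hq0
  have h6 : (1 + q) * D / (q * (1 - 0)) = D + D / q := by
    field_simp
    ring
  rw [h6] at h5
  refine h5.congr' ?_
  filter_upwards [eventually_ge_atTop 1] with M hM
  obtain ⟨k, rfl⟩ : ∃ k, M = k + 1 := ⟨M - 1, by omega⟩
  have := one_sub_pow_ne_zero hq k
  rw [one_add_mul_sum_overProd hq]
  field_simp

lemma overGF_eq_inv {q : ℂ} (hq : ‖q‖ < 1) (hq0 : q ≠ 0) {θ : ℂ}
    (hθ : HasSum (fun s : ℕ => 2 * ((-1) ^ (s + 1) * q ^ ((s + 1) ^ 2))) (θ - 1)) :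
    overGF q = θ⁻¹ := by
  have h1 := (hasSum_overCount_and_tendsto hq hq0).2
  have h2 := tendsto_inv_overProd hq hθ
  have h3 : overGF q * θ = 1 := by
    refine tendsto_nhds_unique (h1.mul h2) ?_
    simp only [mul_inv_cancel₀ (overProd_ne_zero hq _)]
    exact tendsto_const_nhds
  exact eq_inv_of_mul_eq_one_left h3

/-! ### Modular transformation -/

/-- The theta series `∑ exp (-w n (n + 1))` that arises from the alternating theta series under
inversion; it tends to `1` as `Re w → ∞`. -/
noncomputable def dualTheta (w : ℂ) : ℂ := ∑' n : ℕ, Complex.exp (-w * (n * (n + 1)))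

lemma norm_exp_dualTheta_term_le {w : ℂ} (hw : 0 < w.re) (n : ℕ) :
    ‖Complex.exp (-w * (n * (n + 1)))‖ ≤ Real.exp (-(2 * w.re)) ^ n := by
  rw [Complex.norm_exp, ← Real.exp_nat_mul]
  apply Real.exp_le_exp.2
  have : (-w * ((n : ℂ) * (n + 1))).re = -w.re * (n * (n + 1)) := by
    rw [show ((n : ℂ) * (n + 1)) = (((n : ℝ) * (n + 1) : ℝ) : ℂ) by push_cast; ring,
      Complex.re_mul_ofReal, Complex.neg_re]
  rw [this]
  rcases Nat.eq_zero_or_pos n with rfl | hn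
  · simp
  · have : (1 : ℝ) ≤ n := by exact_mod_cast hn
    have h2 : 0 ≤ w.re * (n * (n - 1)) := by
      have : (0 : ℝ) ≤ n - 1 := by linarith
      positivity
    nlinarith

lemma summable_dualTheta {w : ℂ} (hw : 0 < w.re) :
    Summable fun n : ℕ => Complex.exp (-w * (n * (n + 1))) :=
  Summable.of_norm_bounded (summable_geometric_of_lt_one (Real.exp_pos _).le
    (Real.exp_lt_one_iff.2 (by linarith))) (norm_exp_dualTheta_term_le hw)

lemma norm_dualTheta_sub_one_le {w : ℂ} (hw : 0 < w.re) :
    ‖dualTheta w - 1‖ ≤ Real.exp (-(2 * w.re)) * (1 - Real.exp (-(2 * w.re)))⁻¹ := by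
  have hx : Real.exp (-(2 * w.re)) < 1 := Real.exp_lt_one_iff.2 (by linarith)
  have h := (summable_dualTheta hw).tsum_eq_zero_add
  rw [dualTheta, h]
  simp only [Nat.cast_zero, zero_mul, mul_zero, Complex.exp_zero, add_sub_cancel_left]
  refine tsum_of_norm_bounded
    ((hasSum_geometric_of_lt_one (Real.exp_pos _).le hx).mul_left _) fun n => ?_
  rw [← pow_succ']
  exact norm_exp_dualTheta_term_le hw (n + 1)

/-- The modular transformation of the generating function of overpartitions: it is the
reciprocal of a theta series, to which Poisson summation applies. -/
lemma overGF_exp_neg {z : ℂ} (hz : 0 < z.re) :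
    overGF (Complex.exp (-z)) = (z / Real.pi) ^ (1 / 2 : ℂ) *
      Complex.exp (Real.pi ^ 2 / (4 * z)) * (2 * dualTheta (Real.pi ^ 2 / z))⁻¹ := by
  have hpi : (Real.pi : ℂ) ≠ 0 := by exact_mod_cast Real.pi_ne_zero
  have hz0 : z ≠ 0 := by rintro rfl; simp at hz
  have hq : ‖Complex.exp (-z)‖ < 1 := by
    rw [Complex.norm_exp]
    exact Real.exp_lt_one_iff.2 (by simpa using hz)
  have hza : 0 < (z / Real.pi).re := by
    rw [Complex.div_ofReal_re]
    exact div_pos hz Real.pi_pos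
  have hw : 0 < (Real.pi ^ 2 / z : ℂ).re := by
    rw [show (Real.pi ^ 2 / z : ℂ) = ((Real.pi ^ 2 : ℝ) : ℂ) * z⁻¹ by push_cast; rfl,
      Complex.re_ofReal_mul, Complex.inv_re]
    have := Complex.normSq_pos.2 hz0
    positivity
  set q := Complex.exp (-z) with hqdef
  set f : ℤ → ℂ := fun n => Complex.exp (-Real.pi * (z / Real.pi) * (n : ℂ) ^ 2 +
    2 * Real.pi * (-Complex.I / 2) * n) with hf
  have hexp : ∀ k : ℕ, Complex.exp (-z * (k : ℂ) ^ 2) = q ^ (k ^ 2) := by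
    intro k
    rw [hqdef, ← Complex.exp_nat_mul]
    congr 1
    push_cast
    ring
  have hf1 : ∀ k : ℕ, f k = (-1) ^ k * q ^ (k ^ 2) := by
    intro k
    have h1 : Complex.exp (-(Real.pi * Complex.I)) ^ k = (-1) ^ k := by
      rw [Complex.exp_neg, Complex.exp_pi_mul_I]; norm_num
    simp only [hf]
    rw [← hexp, ← h1, ← Complex.exp_nat_mul, ← Complex.exp_add]
    congr 1
    push_cast
    field_simp
    ring
  have hf2 : ∀ k : ℕ, f (-k) = (-1) ^ k * q ^ (k ^ 2) := by
    intro k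
    simp only [hf]
    rw [← hexp, ← Complex.exp_pi_mul_I, ← Complex.exp_nat_mul, ← Complex.exp_add]
    congr 1
    push_cast
    field_simp
    ring
  have hsn : Summable fun k : ℕ => (-1 : ℂ) ^ k * q ^ (k ^ 2) := by
    refine Summable.of_norm_bounded (summable_geometric_of_lt_one (norm_nonneg q) hq) fun k => ?_
    rw [norm_mul, norm_pow, norm_neg, norm_one, one_pow, one_mul, norm_pow]
    exact pow_le_pow_of_le_one (norm_nonneg q) hq.le (Nat.le_self_pow two_ne_zero k)
  have hsum : Summable f := by
    refine Summable.of_nat_of_neg_add_one ?_ ?_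
    · simpa only [hf1] using hsn
    · have := (summable_nat_add_iff 1).2 hsn
      refine this.congr fun k => ?_
      rw [← hf2]
      push_cast
      rfl
  have hθ : HasSum (fun s : ℕ => 2 * ((-1) ^ (s + 1) * q ^ ((s + 1) ^ 2))) (∑' n, f n - 1) := by
    have h0 : f 0 = 1 := by simp [hf]
    have h1 := (hasSum_nat_add_iff' 1).2 hsum.hasSum.nat_add_neg
    simp only [Finset.sum_range_one, Nat.cast_zero, neg_zero, h0] at h1
    rw [show ∑' n, f n + 1 - (1 + 1) = ∑' n, f n - 1 by ring] at h1
    refine h1.congr_fun fun s => ?_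
    rw [hf1, hf2]
    ring
  rw [overGF_eq_inv hq (Complex.exp_ne_zero _) hθ, hf, Complex.tsum_exp_neg_quadratic hza]
  -- The dual series is symmetric about `-1/2`.
  have hg : ∀ n : ℤ, Complex.exp (-Real.pi / (z / Real.pi) *
      ((n : ℂ) + Complex.I * (-Complex.I / 2)) ^ 2) =
      Complex.exp (-(Real.pi ^ 2 / (4 * z))) *
        Complex.exp (-(Real.pi ^ 2 / z) * (n * (n + 1))) := by
    intro n
    rw [← Complex.exp_add]
    congr 1
    have : Complex.I * (-Complex.I / 2) = 1 / 2 := by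
      rw [mul_div_assoc', mul_neg, Complex.I_mul_I, neg_neg]
    rw [this]
    field_simp
    ring
  have hd := (summable_dualTheta hw).hasSum
  have hZ : HasSum (fun n : ℤ => Complex.exp (-(Real.pi ^ 2 / z) * ((n : ℂ) * (n + 1))))
      (dualTheta (Real.pi ^ 2 / z) + dualTheta (Real.pi ^ 2 / z)) := by
    refine HasSum.of_nat_of_neg_add_one ?_ ?_
    · simp only [Int.cast_natCast]; exact hd
    · refine hd.congr_fun fun n => ?_
      congr 1
      push_cast
      ring
  simp only [hg]
  rw [tsum_mul_left, hZ.tsum_eq, Complex.exp_neg, ← two_mul, mul_inv, mul_inv, one_div, inv_inv,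
    inv_inv, mul_assoc]

/-! ### Decay away from the positive real axis -/

/-- With `A = 1 + ρ ^ 2`, the numbers `A + 2 x` and `A - 2 x` are the squared norms of `1 + w` and
`1 - w` when `ρ = ‖w‖` and `x = Re w`. -/
lemma add_mul_sub_le_mul_exp {A ρ x : ℝ} (hA1 : A = 1 + ρ ^ 2) (h0 : 0 ≤ ρ) (h1 : ρ < 1)
    (hx : |x| ≤ ρ) :
    (A + 2 * x) * (A - 2 * ρ) ≤ (A + 2 * ρ) * (A - 2 * x) * Real.exp (-((ρ - x) / 4)) := by
  obtain ⟨hx1, hx2⟩ := abs_le.1 hx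
  have hA2 : 1 ≤ A := by nlinarith
  have hA3 : A ≤ 2 := by nlinarith
  have hA4 : 0 ≤ A - 2 * ρ := by nlinarith [sq_nonneg (1 - ρ)]
  have hB : 0 ≤ (A + 2 * ρ) * (A - 2 * x) := mul_nonneg (by linarith) (by linarith)
  have hB2 : (A + 2 * ρ) * (A - 2 * x) ≤ 16 := by nlinarith
  have h2 := Real.add_one_le_exp (-((ρ - x) / 4))
  calc (A + 2 * x) * (A - 2 * ρ) ≤ (A + 2 * ρ) * (A - 2 * x) * (-((ρ - x) / 4) + 1) := by
        nlinarith [mul_nonneg (sub_nonneg.2 hx2) (sub_nonneg.2 hB2),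
          mul_nonneg (sub_nonneg.2 hx2) (sub_nonneg.2 hA2)]
    _ ≤ _ := mul_le_mul_of_nonneg_left h2 hB

/-- The defect of `‖(1 + w) / (1 - w)‖` from its maximum on the circle through `w`. -/
lemma norm_one_add_div_one_sub_le {w : ℂ} (hw : ‖w‖ < 1) :
    ‖(1 + w) / (1 - w)‖ ≤
      (1 + ‖w‖) / (1 - ‖w‖) * Real.exp (-((‖w‖ - w.re) / 8)) := by
  have hρ : 0 < 1 - ‖w‖ := by linarith
  have hsq : ‖w‖ ^ 2 = w.re ^ 2 + w.im ^ 2 := by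
    rw [Complex.sq_norm, Complex.normSq_apply]; ring
  have e1 : ‖1 + w‖ ^ 2 = 1 + ‖w‖ ^ 2 + 2 * w.re := by
    rw [hsq, Complex.sq_norm, Complex.normSq_apply]; simp; ring
  have e2 : ‖1 - w‖ ^ 2 = 1 + ‖w‖ ^ 2 - 2 * w.re := by
    rw [hsq, Complex.sq_norm, Complex.normSq_apply]; simp; ring
  have hne : 0 < ‖1 - w‖ := by
    have := norm_sub_norm_le 1 w
    rw [norm_one] at this
    linarith
  have h := add_mul_sub_le_mul_exp (A := 1 + ‖w‖ ^ 2) rfl (norm_nonneg w) hw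
    (Complex.abs_re_le_norm w)
  rw [norm_div, div_mul_eq_mul_div, div_le_div_iff₀ hne hρ]
  refine (pow_le_pow_iff_left₀ (by positivity) (by positivity) two_ne_zero).1 ?_
  have e3 : Real.exp (-((‖w‖ - w.re) / 8)) ^ 2 = Real.exp (-((‖w‖ - w.re) / 4)) := by
    rw [← Real.exp_nat_mul]; congr 1; push_cast; ring
  rw [mul_pow, mul_pow, mul_pow, e1, e2, e3]
  calc _ = (1 + ‖w‖ ^ 2 + 2 * w.re) * (1 + ‖w‖ ^ 2 - 2 * ‖w‖) := by ring
    _ ≤ _ := h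
    _ = _ := by ring

lemma overProd_ofReal (r : ℝ) (m : ℕ) : overProd (r : ℂ) m = ((overProd r m : ℝ) : ℂ) := by
  simp [overProd]

/-- Away from the positive real axis the generating function is small. -/
lemma norm_overGF_le {q : ℂ} (hq : ‖q‖ < 1) (hq0 : q ≠ 0) :
    ‖overGF q‖ ≤ ‖overGF (‖q‖ : ℂ)‖ *
      Real.exp (-(((1 - ‖q‖)⁻¹ - ‖1 - q‖⁻¹) / 8)) := by
  have hr : ‖(‖q‖ : ℂ)‖ < 1 := by simpa using hq
  have hr0 : (‖q‖ : ℂ) ≠ 0 := by simpa using hq0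
  have h1 := (hasSum_overCount_and_tendsto hq hq0).2.norm
  have h2 := (hasSum_overCount_and_tendsto hr hr0).2.norm
  have hm : ∀ m, ‖overProd q m‖ ≤ ‖overProd (‖q‖ : ℂ) m‖ *
      Real.exp (-((∑ k ∈ Finset.range m, (‖q‖ ^ (k + 1) - (q ^ (k + 1)).re)) / 8)) := by
    intro m
    rw [overProd_ofReal, Complex.norm_real, Real.norm_of_nonneg
      (overProd_pos (norm_nonneg q) hq m).le, overProd, norm_prod, overProd, Finset.sum_div,
      ← Finset.sum_neg_distrib, Real.exp_sum, ← Finset.prod_mul_distrib]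
    refine Finset.prod_le_prod (fun _ _ => norm_nonneg _) fun k _ => ?_
    have := norm_one_add_div_one_sub_le (w := q ^ (k + 1)) (by
      rw [norm_pow]; exact pow_lt_one₀ (norm_nonneg _) hq (by omega))
    rwa [norm_pow] at this
  have g1 : HasSum (fun k : ℕ => q ^ (k + 1)) (q * (1 - q)⁻¹) := by
    simpa only [pow_succ'] using (hasSum_geometric_of_norm_lt_one hq).mul_left q
  have g2 : HasSum (fun k : ℕ => ‖q‖ ^ (k + 1)) (‖q‖ * (1 - ‖q‖)⁻¹) := by
    simpa only [pow_succ'] using (hasSum_geometric_of_lt_one (norm_nonneg q) hq).mul_left ‖q‖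
  have g3 := (g2.sub (Complex.hasSum_re g1)).tendsto_sum_nat
  have h3 := le_of_tendsto_of_tendsto' h1
    (h2.mul ((Real.continuous_exp.tendsto _).comp (g3.div_const 8).neg)) hm
  refine h3.trans (mul_le_mul_of_nonneg_left (Real.exp_le_exp.2 ?_) (norm_nonneg _))
  have hne : 1 - q ≠ 0 := by simpa using one_sub_pow_ne_zero hq 0
  have hne' : 1 - ‖q‖ ≠ 0 := by linarith
  have k1 : q * (1 - q)⁻¹ = (1 - q)⁻¹ - 1 := by field_simp; ring
  have k2 : ‖q‖ * (1 - ‖q‖)⁻¹ = (1 - ‖q‖)⁻¹ - 1 := by field_simp; ring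
  have k3 : ((1 - q)⁻¹).re ≤ ‖1 - q‖⁻¹ := by
    rw [← norm_inv]; exact Complex.re_le_norm _
  rw [k1, k2, Complex.sub_re, Complex.one_re]
  linarith

/-! ### Coefficients as circle integrals -/

lemma norm_exp_neg_lt_one {z : ℂ} (hz : 0 < z.re) : ‖Complex.exp (-z)‖ < 1 := by
  rw [Complex.norm_exp]
  exact Real.exp_lt_one_iff.2 (by simpa using hz)

lemma integral_exp_int_mul_I {k : ℤ} (hk : k ≠ 0) :
    ∫ θ in (-Real.pi)..Real.pi, Complex.exp (k * Complex.I * θ) = 0 := by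
  have hc : (k : ℂ) * Complex.I ≠ 0 := mul_ne_zero (by exact_mod_cast hk) Complex.I_ne_zero
  rw [integral_exp_mul_complex hc, div_eq_zero_iff, sub_eq_zero]
  left
  rw [Complex.exp_eq_exp_iff_exists_int]
  exact ⟨k, by push_cast; ring⟩

lemma hasSum_overGF_exp {t : ℝ} (ht : 0 < t) (θ : ℝ) :
    HasSum (fun m : ℕ => (overCount m : ℂ) * Complex.exp (-(t - θ * Complex.I)) ^ m)
      (overGF (Complex.exp (-(t - θ * Complex.I)))) :=
  (hasSum_overCount_and_tendsto (norm_exp_neg_lt_one (by simpa using ht))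
    (Complex.exp_ne_zero _)).1

lemma norm_overCount_term {t : ℝ} (θ : ℝ) (m : ℕ) :
    ‖(overCount m : ℂ) * Complex.exp (-(t - θ * Complex.I)) ^ m‖ =
      overCount m * Real.exp (-t) ^ m := by
  rw [norm_mul, norm_pow, Complex.norm_exp, Complex.norm_natCast]
  simp

lemma summable_overCount {t : ℝ} (ht : 0 < t) :
    Summable fun m : ℕ => (overCount m : ℝ) * Real.exp (-t) ^ m := by
  have := (hasSum_overGF_exp ht 0).summable.norm
  simpa only [norm_overCount_term] using this

lemma continuous_overGF_exp {t : ℝ} (ht : 0 < t) :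
    Continuous fun θ : ℝ => overGF (Complex.exp (-(t - θ * Complex.I))) := by
  unfold overGF
  refine continuous_tsum (fun m => by fun_prop) (summable_overCount ht) fun m θ => ?_
  rw [norm_overCount_term]

/-- Cauchy's formula for the coefficients of the generating function. -/
lemma integral_overGF_exp {t : ℝ} (ht : 0 < t) (n : ℕ) :
    ∫ θ in (-Real.pi)..Real.pi, overGF (Complex.exp (-(t - θ * Complex.I))) *
      Complex.exp (n * (t - θ * Complex.I)) = 2 * Real.pi * overCount n := by
  have hterm : ∀ (m : ℕ) (θ : ℝ),
      (overCount m : ℂ) * Complex.exp (-(t - θ * Complex.I)) ^ m *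
        Complex.exp (n * (t - θ * Complex.I)) =
      overCount m * Complex.exp (((n : ℤ) - (m : ℤ) : ℤ) * t) *
        Complex.exp (((m : ℤ) - (n : ℤ) : ℤ) * Complex.I * θ) := by
    intro m θ
    rw [← Complex.exp_nat_mul, mul_assoc, mul_assoc, ← Complex.exp_add, ← Complex.exp_add]
    congr 2
    push_cast
    ring
  have h := intervalIntegral.hasSum_integral_of_dominated_convergence (μ := volume)
    (a := -Real.pi) (b := Real.pi)
    (F := fun (m : ℕ) (θ : ℝ) => (overCount m : ℂ) * Complex.exp (-(t - θ * Complex.I)) ^ m *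
        Complex.exp (n * (t - θ * Complex.I)))
    (f := fun θ : ℝ => overGF (Complex.exp (-(t - θ * Complex.I))) *
      Complex.exp (n * (t - θ * Complex.I)))
    (fun m _ => (overCount m : ℝ) * Real.exp (-t) ^ m * Real.exp (n * t))
    (fun m => (by fun_prop : Continuous _).aestronglyMeasurable)
    (fun m => ae_of_all _ fun θ _ => by
      rw [norm_mul, norm_overCount_term, Complex.norm_exp]
      simp)
    (ae_of_all _ fun θ _ => (summable_overCount ht).mul_right _)
    intervalIntegrable_const
    (ae_of_all _ fun θ _ => (hasSum_overGF_exp ht θ).mul_right _)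
  refine h.unique ?_
  have hn : (fun m : ℕ => ∫ θ in (-Real.pi)..Real.pi, (overCount m : ℂ) *
      Complex.exp (-(t - θ * Complex.I)) ^ m * Complex.exp (n * (t - θ * Complex.I))) =
      fun m => if m = n then 2 * Real.pi * (overCount n : ℂ) else 0 := by
    funext m
    simp only [hterm]
    rw [intervalIntegral.integral_const_mul]
    split_ifs with hmn
    · subst hmn
      simp
      ring
    · rw [integral_exp_int_mul_I (by omega), mul_zero]
  rw [hn]
  exact hasSum_ite_eq n _

/-- The integrand on the circle of radius `exp (-π ^ 2 / (4 s ^ 2))` around the origin, at the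
angle `π ^ 2 v / (4 s ^ 3)`, normalised so as to converge to `exp (-v ^ 2)` as `s → ∞`. The
integral recovers the coefficient of index `4 s ^ 4 / π ^ 2`. -/
noncomputable def circleKernel (s v : ℝ) : ℂ :=
  overGF (Complex.exp (-((Real.pi ^ 2 / (4 * s ^ 2) : ℝ) * (1 - (v / s : ℝ) * Complex.I)))) *
    Complex.exp ((s ^ 2 : ℝ) * (1 - (v / s : ℝ) * Complex.I) - 2 * (s ^ 2 : ℝ)) *
    (4 * s / √Real.pi : ℝ)

lemma circleKernel_eq {s : ℝ} (hs : 0 < s) (v : ℝ) :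
    circleKernel s v = (1 - (v / s : ℝ) * Complex.I) ^ (1 / 2 : ℂ) *
      Complex.exp (-(v ^ 2 : ℝ) / (1 - (v / s : ℝ) * Complex.I)) *
      (dualTheta ((4 * s ^ 2 : ℝ) / (1 - (v / s : ℝ) * Complex.I)))⁻¹ := by
  have hpi := Real.pi_pos
  have hv : (v : ℂ) = (v / s : ℝ) * s := by
    rw [← Complex.ofReal_mul, div_mul_cancel₀ _ hs.ne']
  have hv2 : ((v ^ 2 : ℝ) : ℂ) = ((v / s : ℝ) : ℂ) ^ 2 * (s : ℂ) ^ 2 := by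
    rw [← mul_pow, ← hv]; push_cast; rfl
  rw [circleKernel, hv2]
  set u : ℝ := v / s
  set y : ℂ := 1 - (u : ℂ) * Complex.I with hy
  have hyre : y.re = 1 := by simp [hy]
  have hy0 : y ≠ 0 := by
    intro h
    rw [h] at hyre
    simp at hyre
  have hsC : (s : ℂ) ≠ 0 := by exact_mod_cast hs.ne'
  have hpC : (Real.pi : ℂ) ≠ 0 := by exact_mod_cast hpi.ne'
  have hz : 0 < (((Real.pi ^ 2 / (4 * s ^ 2) : ℝ) : ℂ) * y).re := by
    rw [Complex.re_ofReal_mul, hyre, mul_one]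
    positivity
  rw [overGF_exp_neg hz]
  have e1 : ((Real.pi ^ 2 / (4 * s ^ 2) : ℝ) : ℂ) * y / Real.pi =
      ((Real.pi / (4 * s ^ 2) : ℝ) : ℂ) * y := by
    push_cast
    field_simp
  have hr : 0 < Real.pi / (4 * s ^ 2) := by positivity
  have e2 : (((Real.pi / (4 * s ^ 2) : ℝ) : ℂ) * y) ^ (1 / 2 : ℂ) =
      ((√Real.pi / (2 * s) : ℝ) : ℂ) * y ^ (1 / 2 : ℂ) := by
    have hsq : √Real.pi / (2 * s) = √(Real.pi / (4 * s ^ 2)) := by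
      rw [Real.sqrt_div hpi.le, show 4 * s ^ 2 = (2 * s) ^ 2 by ring, Real.sqrt_sq (by positivity)]
    rw [hsq, Complex.cpow_def_of_ne_zero (mul_ne_zero (by exact_mod_cast hr.ne') hy0),
      Complex.log_ofReal_mul hr hy0, add_mul, Complex.exp_add,
      ← Complex.cpow_def_of_ne_zero hy0, Real.sqrt_eq_rpow, Real.rpow_def_of_pos hr]
    push_cast
    rfl
  have e3 : (Real.pi : ℂ) ^ 2 / (4 * (((Real.pi ^ 2 / (4 * s ^ 2) : ℝ) : ℂ) * y)) =
      (s : ℂ) ^ 2 / y := by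
    push_cast
    field_simp
  have e4 : (Real.pi : ℂ) ^ 2 / (((Real.pi ^ 2 / (4 * s ^ 2) : ℝ) : ℂ) * y) =
      ((4 * s ^ 2 : ℝ) : ℂ) / y := by
    push_cast
    field_simp
  have e5 : Complex.exp (-(((u : ℂ) ^ 2 * (s : ℂ) ^ 2)) / y) =
      Complex.exp ((s : ℂ) ^ 2 / y) * Complex.exp ((s ^ 2 : ℝ) * y - 2 * (s ^ 2 : ℝ)) := by
    rw [← Complex.exp_add]
    congr 1
    have hu : (u : ℂ) ^ 2 = - (1 - y) ^ 2 := by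
      rw [hy, sub_sub_cancel, mul_pow, Complex.I_sq]; ring
    rw [hu]
    push_cast
    field_simp
    ring
  have e6 : ((√Real.pi / (2 * s) : ℝ) : ℂ) * ((4 * s / √Real.pi : ℝ) : ℂ) = 2 := by
    rw [← Complex.ofReal_mul]
    have : √Real.pi ≠ 0 := (Real.sqrt_pos.2 hpi).ne'
    rw [show √Real.pi / (2 * s) * (4 * s / √Real.pi) = 2 by field_simp; norm_num]
    rfl
  rw [e1, e2, e3, e4, e5, mul_inv]
  linear_combination (y ^ (1 / 2 : ℂ) * Complex.exp ((s : ℂ) ^ 2 / y) *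
    Complex.exp ((s ^ 2 : ℝ) * y - 2 * (s ^ 2 : ℝ)) *
    (dualTheta (((4 * s ^ 2 : ℝ) : ℂ) / y))⁻¹ / 2) * e6

lemma re_ofReal_div_one_sub (c u : ℝ) :
    ((c : ℂ) / (1 - (u : ℂ) * Complex.I)).re = c / (1 + u ^ 2) := by
  rw [div_eq_mul_inv, Complex.re_ofReal_mul, Complex.inv_re, Complex.normSq_apply]
  simp
  rw [div_eq_mul_inv]
  ring

/-- On the major arc, the transformed theta series gives a Gaussian bound. -/
lemma norm_circleKernel_le_of_abs_le {s v : ℝ} (hs : 1 ≤ s) (hv : |v| ≤ s) :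
    ‖circleKernel s v‖ ≤ 6 * (1 + v ^ 2)⁻¹ := by
  have hs0 : 0 < s := by linarith
  rw [circleKernel_eq hs0]
  have hu : (v / s) ^ 2 ≤ 1 := by
    rw [sq_le_one_iff_abs_le_one, abs_div, abs_of_pos hs0, div_le_one hs0]
    exact hv
  set u := v / s
  have h1 : ‖(1 - (u : ℂ) * Complex.I) ^ (1 / 2 : ℂ)‖ ≤ 3 / 2 := by
    rw [show (1 / 2 : ℂ) = ((1 / 2 : ℝ) : ℂ) by push_cast; rfl, Complex.norm_cpow_real,
      ← Real.sqrt_eq_rpow]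
    refine Real.sqrt_le_iff.2 ⟨by norm_num, ?_⟩
    have : ‖1 - (u : ℂ) * Complex.I‖ ≤ 1 + |u| := by
      refine (norm_sub_le _ _).trans ?_
      simp
    have : |u| ≤ 1 := (sq_le_one_iff_abs_le_one u).1 hu
    linarith
  have h2 : ‖Complex.exp (-(v ^ 2 : ℝ) / (1 - (u : ℂ) * Complex.I))‖ ≤ 2 * (1 + v ^ 2)⁻¹ := by
    rw [Complex.norm_exp, ← Complex.ofReal_neg, re_ofReal_div_one_sub]
    have : -v ^ 2 / (1 + u ^ 2) ≤ -(v ^ 2 / 2) := by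
      rw [neg_div]
      gcongr
      linarith
    refine (Real.exp_le_exp.2 this).trans ?_
    rw [Real.exp_neg, ← div_eq_mul_inv, ← one_div, div_le_div_iff₀ (Real.exp_pos _) (by positivity)]
    have := Real.add_one_le_exp (v ^ 2 / 2)
    linarith [sq_nonneg v]
  have h3 : ‖(dualTheta ((4 * s ^ 2 : ℝ) / (1 - (u : ℂ) * Complex.I)))⁻¹‖ ≤ 2 := by
    have hre := re_ofReal_div_one_sub (4 * s ^ 2) u
    set w := ((4 * s ^ 2 : ℝ) : ℂ) / (1 - (u : ℂ) * Complex.I)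
    have hw : 2 ≤ w.re := by
      rw [hre, le_div_iff₀ (by positivity)]
      nlinarith
    have hx : Real.exp (-(2 * w.re)) ≤ 1 / 3 := by
      rw [Real.exp_neg, ← one_div]
      apply one_div_le_one_div_of_le (by norm_num)
      have := Real.add_one_le_exp (2 * w.re)
      linarith
    have hE := norm_dualTheta_sub_one_le (w := w) (by linarith)
    have hE2 : Real.exp (-(2 * w.re)) * (1 - Real.exp (-(2 * w.re)))⁻¹ ≤ 1 / 2 := by
      rw [← div_eq_mul_inv, div_le_iff₀ (by linarith)]
      linarith
    have hE3 := norm_sub_norm_le 1 (1 - dualTheta w)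
    rw [sub_sub_cancel, norm_one, norm_sub_rev] at hE3
    rw [norm_inv]
    exact inv_le_of_inv_le₀ (by norm_num) (by norm_num; linarith)
  rw [norm_mul, norm_mul]
  calc _ ≤ 3 / 2 * (2 * (1 + v ^ 2)⁻¹) * 2 := by gcongr
    _ = _ := by ring

/-- The generating function on the minor arc is smaller than at the positive real point by an
exponential factor. -/
lemma norm_overGF_minor_arc {t θ : ℝ} (ht : 0 < t) (ht2 : t ≤ 1 / 2) (h1 : t ≤ |θ|)
    (h2 : |θ| ≤ Real.pi) :
    ‖overGF (Complex.exp (-(t - θ * Complex.I)))‖ ≤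
      ‖overGF (Complex.exp (-t))‖ * Real.exp (-(1 / (100 * t))) := by
  have hn : ‖Complex.exp (-(t - θ * Complex.I))‖ = Real.exp (-t) := by
    rw [Complex.norm_exp]; simp
  have h := norm_overGF_le (q := Complex.exp (-(t - θ * Complex.I)))
    (norm_exp_neg_lt_one (by simpa using ht)) (Complex.exp_ne_zero _)
  rw [hn] at h
  have hr1 : 1 - t ≤ Real.exp (-t) := by linarith [Real.add_one_le_exp (-t)]
  have hr2 : Real.exp (-t) < 1 := Real.exp_lt_one_iff.2 (by linarith)
  have hqn : ‖1 - Complex.exp (-(t - θ * Complex.I))‖ ^ 2 =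
      1 + Real.exp (-t) ^ 2 - 2 * (Real.exp (-t) * Real.cos θ) := by
    rw [show -((t : ℂ) - θ * Complex.I) = ((-t : ℝ) : ℂ) + θ * Complex.I by push_cast; ring,
      Complex.exp_add, ← Complex.ofReal_exp, Complex.exp_mul_I, Complex.sq_norm,
      Complex.normSq_apply, ← Complex.ofReal_cos, ← Complex.ofReal_sin]
    have hcs := Real.sin_sq_add_cos_sq θ
    generalize Real.exp (-t) = r
    generalize Real.cos θ = c at *
    generalize Real.sin θ = σ at *
    simp
    linear_combination r ^ 2 * hcs
  rw [show Complex.exp (-(t : ℂ)) = ((Real.exp (-t) : ℝ) : ℂ) by push_cast; rfl]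
  set r := Real.exp (-t)
  set d := ‖1 - Complex.exp (-(t - θ * Complex.I))‖
  -- The point `q` is farther from `1` than `r` is, by a factor whose square is at least `6 / 5`;
  -- the factor `109 / 100` is below the root of `6 / 5`.
  have hcos := Real.cos_le_one_sub_mul_cos_sq h2
  have hpi2 : Real.pi ^ 2 ≤ 10 := by nlinarith [Real.pi_lt_d2, Real.pi_pos]
  have hθ : (1 - r) ^ 2 ≤ θ ^ 2 := by
    rw [← sq_abs θ]
    have : 1 - r ≤ |θ| := by linarith
    exact pow_le_pow_left₀ (by linarith) this 2
  have hc2 : (1 / 5) * (1 - r) ^ 2 ≤ 2 / Real.pi ^ 2 * θ ^ 2 := by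
    have : 1 / 5 ≤ 2 / Real.pi ^ 2 := by
      rw [div_le_div_iff₀ (by norm_num) (by positivity)]
      linarith
    gcongr
  have hd : ((109 / 100) * (1 - r)) ^ 2 ≤ d ^ 2 := by
    rw [hqn]
    nlinarith
  have hd' : (109 / 100) * (1 - r) ≤ d :=
    (pow_le_pow_iff_left₀ (by linarith) (norm_nonneg _) two_ne_zero).1 hd
  have hdi : d⁻¹ ≤ ((109 / 100) * (1 - r))⁻¹ :=
    inv_anti₀ (by linarith) hd'
  rw [mul_inv] at hdi
  have hti : t⁻¹ ≤ (1 - r)⁻¹ := inv_anti₀ (by linarith) (by linarith)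
  refine h.trans (mul_le_mul_of_nonneg_left (Real.exp_le_exp.2 ?_) (norm_nonneg _))
  rw [one_div, mul_inv]
  have : 0 < t⁻¹ := inv_pos.2 ht
  norm_num at hdi ⊢
  linarith

lemma norm_circleKernel (s v : ℝ) :
    ‖circleKernel s v‖ =
      ‖overGF (Complex.exp (-((Real.pi ^ 2 / (4 * s ^ 2) : ℝ) -
        (Real.pi ^ 2 / (4 * s ^ 2) * (v / s) : ℝ) * Complex.I)))‖ *
      Real.exp (-s ^ 2) * ‖4 * s / √Real.pi‖ := by
  rw [circleKernel, norm_mul, norm_mul, Complex.norm_exp, Complex.norm_real]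
  congr 3
  · congr 3
    push_cast
    ring
  · generalize s ^ 2 = S
    simp [Complex.mul_re]
    ring

/-- An integrable bound that is uniform in `s`, on the range of `v` that makes up the circle. -/
lemma norm_circleKernel_le {s v : ℝ} (hs : 3 ≤ s) (hv : |v| ≤ 4 * s ^ 3 / Real.pi) :
    ‖circleKernel s v‖ ≤ 2000000000 * (1 + v ^ 2)⁻¹ := by
  have hs0 : 0 < s := by linarith
  have hpi := Real.pi_pos
  have hpi3 := Real.pi_gt_three
  have hpi2 : Real.pi ^ 2 ≤ 10 := by nlinarith [Real.pi_lt_d2, Real.pi_pos]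
  rcases le_or_gt |v| s with h | h
  · refine (norm_circleKernel_le_of_abs_le (by linarith) h).trans ?_
    gcongr
    norm_num
  · have h0 := norm_circleKernel_le_of_abs_le (s := s) (v := 0) (by linarith)
      (by simpa using hs0.le)
    rw [norm_circleKernel] at h0 ⊢
    set t := Real.pi ^ 2 / (4 * s ^ 2) with ht
    have ht0 : 0 < t := by positivity
    have ht2 : t ≤ 1 / 2 := by
      rw [ht, div_le_div_iff₀ (by positivity) (by norm_num)]
      nlinarith
    have habs : |t * (v / s)| = t * (|v| / s) := by
      rw [abs_mul t, abs_of_pos ht0, abs_div, abs_of_pos hs0]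
    have hm := norm_overGF_minor_arc (t := t) (θ := t * (v / s)) ht0 ht2 (by
        rw [habs]
        have : 1 ≤ |v| / s := by rw [le_div_iff₀ hs0]; linarith
        nlinarith) (by
        rw [habs]
        calc t * (|v| / s) ≤ t * (4 * s ^ 3 / Real.pi / s) := by gcongr
          _ = Real.pi := by rw [ht]; field_simp)
    simp only [zero_div, mul_zero, Complex.ofReal_zero, zero_mul, sub_zero, ne_eq,
      OfNat.ofNat_ne_zero, not_false_eq_true, zero_pow, add_zero, inv_one, mul_one] at h0
    -- The exponential saving, of order `exp (-s ^ 2 / 250)`, beats `1 + v ^ 2 ≤ 3 s ^ 6`.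
    have hy : Real.exp (-(1 / (100 * t))) ≤ 300000000 * (1 + v ^ 2)⁻¹ := by
      have hyt : s ^ 2 / 250 ≤ 1 / (100 * t) := by
        rw [ht, show 1 / (100 * (Real.pi ^ 2 / (4 * s ^ 2))) = s ^ 2 / (25 * Real.pi ^ 2) by
          field_simp; norm_num]
        gcongr
        linarith
      have hfac := Real.pow_div_factorial_le_exp (s ^ 2 / 250) (by positivity) 3
      have hv2 : 1 + v ^ 2 ≤ 3 * s ^ 6 := by
        have h1 : v ^ 2 ≤ (4 * s ^ 3 / Real.pi) ^ 2 := by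
          rw [← sq_abs v]
          exact pow_le_pow_left₀ (abs_nonneg _) hv 2
        have h2 : (4 * s ^ 3 / Real.pi) ^ 2 ≤ 2 * s ^ 6 := by
          rw [div_pow, div_le_iff₀ (by positivity)]
          have : 9 ≤ Real.pi ^ 2 := by nlinarith
          nlinarith [pow_pos hs0 6]
        have h3 : 1 ≤ s ^ 6 := one_le_pow₀ (by linarith)
        linarith
      rw [Real.exp_neg, ← one_div, ← div_eq_mul_inv, div_le_div_iff₀ (Real.exp_pos _)
        (by positivity), one_mul]
      have h4 := hfac.trans (Real.exp_le_exp.2 hyt)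
      have h5 : (s ^ 2 / 250) ^ 3 / (Nat.factorial 3 : ℝ) = s ^ 6 / 93750000 := by
        rw [show (Nat.factorial 3 : ℝ) = 6 by norm_num [Nat.factorial]]
        ring
      rw [h5] at h4
      linarith [Real.exp_pos (1 / (100 * t))]
    calc _ ≤ ‖overGF (Complex.exp (-(t : ℂ)))‖ * (300000000 * (1 + v ^ 2)⁻¹) *
          Real.exp (-s ^ 2) * ‖4 * s / √Real.pi‖ := by
          gcongr
          exact hm.trans (by gcongr)
      _ = (‖overGF (Complex.exp (-(t : ℂ)))‖ * Real.exp (-s ^ 2) * ‖4 * s / √Real.pi‖) *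
          (300000000 * (1 + v ^ 2)⁻¹) := by ring
      _ ≤ 6 * (300000000 * (1 + v ^ 2)⁻¹) := by gcongr
      _ ≤ _ := by
          have : 0 < (1 + v ^ 2)⁻¹ := by positivity
          linarith

/-! ### The saddle point asymptotics -/

lemma tendsto_dualTheta {w : ℝ → ℂ} (hw : Tendsto (fun s => (w s).re) atTop atTop) :
    Tendsto (fun s => dualTheta (w s)) atTop (𝓝 1) := by
  have h1 : Tendsto (fun s => Real.exp (-(2 * (w s).re))) atTop (𝓝 0) :=
    Real.tendsto_exp_neg_atTop_nhds_zero.comp (hw.const_mul_atTop two_pos)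
  have h2 : Tendsto (fun s => Real.exp (-(2 * (w s).re)) *
      (1 - Real.exp (-(2 * (w s).re)))⁻¹) atTop (𝓝 0) := by
    simpa using h1.mul ((h1.const_sub 1).inv₀ (by norm_num))
  rw [tendsto_iff_norm_sub_tendsto_zero]
  refine squeeze_zero' (Eventually.of_forall fun _ => norm_nonneg _) ?_ h2
  filter_upwards [hw.eventually_gt_atTop 0] with s hs
  exact norm_dualTheta_sub_one_le hs

/-- Pointwise convergence of the integrand to the Gaussian. -/
lemma tendsto_circleKernel (v : ℝ) :
    Tendsto (fun s => circleKernel s v) atTop (𝓝 (Complex.exp (-(v ^ 2 : ℝ)))) := by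
  have hu : Tendsto (fun s : ℝ => v / s) atTop (𝓝 0) := tendsto_const_nhds.div_atTop tendsto_id
  have huC : Tendsto (fun s : ℝ => 1 - ((v / s : ℝ) : ℂ) * Complex.I) atTop (𝓝 1) := by
    simpa using (((Complex.continuous_ofReal.tendsto 0).comp hu).mul_const Complex.I).const_sub 1
  have h1 : Tendsto (fun s : ℝ => (1 - ((v / s : ℝ) : ℂ) * Complex.I) ^ (1 / 2 : ℂ)) atTop
      (𝓝 1) := by
    have : ContinuousAt (fun y : ℂ => y ^ (1 / 2 : ℂ)) 1 :=
      continuousAt_cpow_const (by simp)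
    simpa [Function.comp_def] using this.tendsto.comp huC
  have h2 : Tendsto (fun s : ℝ => Complex.exp (-(v ^ 2 : ℝ) /
      (1 - ((v / s : ℝ) : ℂ) * Complex.I))) atTop (𝓝 (Complex.exp (-(v ^ 2 : ℝ) / 1))) :=
    (Complex.continuous_exp.tendsto _).comp (tendsto_const_nhds.div huC one_ne_zero)
  have h3 : Tendsto (fun s : ℝ => dualTheta ((4 * s ^ 2 : ℝ) /
      (1 - ((v / s : ℝ) : ℂ) * Complex.I))) atTop (𝓝 1) := by
    refine tendsto_dualTheta ?_
    simp only [re_ofReal_div_one_sub]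
    have hsq : Tendsto (fun s : ℝ => 4 * s ^ 2) atTop atTop :=
      (tendsto_pow_atTop two_ne_zero).const_mul_atTop four_pos
    have hinv : Tendsto (fun s : ℝ => (1 + (v / s) ^ 2)⁻¹) atTop (𝓝 1) := by
      simpa using ((hu.pow 2).const_add 1).inv₀ (by norm_num)
    simpa only [div_eq_mul_inv] using hsq.atTop_mul_pos one_pos hinv
  have h4 := (h1.mul h2).mul (h3.inv₀ one_ne_zero)
  rw [one_mul, inv_one, mul_one, div_one] at h4
  refine h4.congr' ?_
  filter_upwards [eventually_gt_atTop 0] with s hs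
  exact (circleKernel_eq hs v).symm

lemma continuous_circleKernel {s : ℝ} (hs : 0 < s) : Continuous (circleKernel s) := by
  have ht : 0 < Real.pi ^ 2 / (4 * s ^ 2) := by
    have := Real.pi_pos
    positivity
  have h1 : Continuous fun v : ℝ => overGF (Complex.exp (-((Real.pi ^ 2 / (4 * s ^ 2) : ℝ) *
      (1 - (v / s : ℝ) * Complex.I)))) := by
    have := (continuous_overGF_exp ht).comp
      (by fun_prop : Continuous fun v : ℝ => Real.pi ^ 2 / (4 * s ^ 2) * (v / s))
    convert this using 2 with v
    simp only [Function.comp_apply]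
    congr 3
    push_cast
    ring
  unfold circleKernel
  exact (h1.mul (by fun_prop)).mul continuous_const

/-- The circle integral converges to the Gaussian integral. -/
lemma tendsto_integral_circleKernel :
    Tendsto (fun s : ℝ => ∫ v in (-(4 * s ^ 3 / Real.pi))..(4 * s ^ 3 / Real.pi),
      circleKernel s v) atTop (𝓝 (√Real.pi : ℝ)) := by
  have hpi := Real.pi_pos
  have hlim : ∫ v : ℝ, Complex.exp (-(v ^ 2 : ℝ)) = (√Real.pi : ℝ) := by
    have := integral_gaussian 1
    rw [div_one] at this
    rw [← this, ← integral_complex_ofReal]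
    refine integral_congr_ae (ae_of_all _ fun v => ?_)
    push_cast
    simp
  rw [← hlim]
  have key := tendsto_integral_filter_of_dominated_convergence (μ := volume) (l := atTop)
    (F := fun (s : ℝ) (v : ℝ) => (Set.Ioc (-(4 * s ^ 3 / Real.pi)) (4 * s ^ 3 / Real.pi)).indicator
      (circleKernel s) v)
    (f := fun v : ℝ => Complex.exp (-(v ^ 2 : ℝ)))
    (fun v => 2000000000 * (1 + v ^ 2)⁻¹) ?_ ?_ (integrable_inv_one_add_sq.const_mul _) ?_
  · refine key.congr' ?_
    filter_upwards [eventually_gt_atTop 0] with s hs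
    rw [integral_indicator measurableSet_Ioc, intervalIntegral.integral_of_le]
    have : 0 < 4 * s ^ 3 / Real.pi := by positivity
    linarith
  · filter_upwards [eventually_gt_atTop 0] with s hs
    exact (continuous_circleKernel hs).aestronglyMeasurable.indicator measurableSet_Ioc
  · filter_upwards [eventually_ge_atTop 3] with s hs
    refine ae_of_all _ fun v => ?_
    by_cases hv : v ∈ Set.Ioc (-(4 * s ^ 3 / Real.pi)) (4 * s ^ 3 / Real.pi)
    · rw [Set.indicator_of_mem hv]
      exact norm_circleKernel_le hs (abs_le.2 ⟨hv.1.le, hv.2⟩)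
    · rw [Set.indicator_of_notMem hv, norm_zero]
      positivity
  · refine ae_of_all _ fun v => (tendsto_circleKernel v).congr' ?_
    filter_upwards [eventually_ge_atTop 1, eventually_gt_atTop |v|] with s hs hsv
    rw [Set.indicator_of_mem]
    have : s ≤ 4 * s ^ 3 / Real.pi := by
      rw [le_div_iff₀ hpi]
      have h1 : s * 1 ≤ s * s ^ 2 := mul_le_mul_of_nonneg_left (one_le_pow₀ hs) (by linarith)
      nlinarith [Real.pi_le_four]
    have := abs_lt.1 hsv
    exact ⟨by linarith, by linarith⟩

/-- The coefficient as a circle integral, with the saddle point as radius. -/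
lemma overCount_eq {n : ℕ} {s : ℝ} (hs : 0 < s) (hn : (n : ℝ) = 4 * s ^ 4 / Real.pi ^ 2) :
    (overCount n : ℂ) = (Real.exp (2 * s ^ 2) / (8 * n) / √Real.pi : ℝ) *
      ∫ v in (-(4 * s ^ 3 / Real.pi))..(4 * s ^ 3 / Real.pi), circleKernel s v := by
  have hpi := Real.pi_pos
  have ht : 0 < Real.pi ^ 2 / (4 * s ^ 2) := by positivity
  have hsC : (s : ℂ) ≠ 0 := by exact_mod_cast hs.ne'
  have hpC : (Real.pi : ℂ) ≠ 0 := by exact_mod_cast hpi.ne'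
  have hnC : (n : ℂ) = 4 * s ^ 4 / Real.pi ^ 2 := by
    have := congrArg (fun x : ℝ => (x : ℂ)) hn
    push_cast at this
    exact this
  set c : ℝ := Real.pi ^ 2 / (4 * s ^ 3) with hc
  have hc0 : c ≠ 0 := by positivity
  have h := integral_overGF_exp ht n
  have hcv := intervalIntegral.integral_comp_mul_left (a := -(4 * s ^ 3 / Real.pi))
    (b := 4 * s ^ 3 / Real.pi) (fun θ : ℝ =>
      overGF (Complex.exp (-((Real.pi ^ 2 / (4 * s ^ 2) : ℝ) - θ * Complex.I))) *
      Complex.exp (n * ((Real.pi ^ 2 / (4 * s ^ 2) : ℝ) - θ * Complex.I))) hc0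
  have hend : c * (4 * s ^ 3 / Real.pi) = Real.pi := by rw [hc]; field_simp
  rw [mul_neg, hend, h] at hcv
  have hpt : ∀ v : ℝ, circleKernel s v =
      (Real.exp (-(2 * s ^ 2)) * (4 * s / √Real.pi) : ℝ) *
      (overGF (Complex.exp (-((Real.pi ^ 2 / (4 * s ^ 2) : ℝ) - (c * v : ℝ) * Complex.I))) *
      Complex.exp (n * ((Real.pi ^ 2 / (4 * s ^ 2) : ℝ) - (c * v : ℝ) * Complex.I))) := by
    intro v
    have e1 : ((Real.pi ^ 2 / (4 * s ^ 2) : ℝ) : ℂ) * (1 - (v / s : ℝ) * Complex.I) =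
        (Real.pi ^ 2 / (4 * s ^ 2) : ℝ) - (c * v : ℝ) * Complex.I := by
      rw [hc]; push_cast; field_simp
    have e2 : ((s ^ 2 : ℝ) : ℂ) * (1 - (v / s : ℝ) * Complex.I) - 2 * (s ^ 2 : ℝ) =
        ((-(2 * s ^ 2) : ℝ) : ℂ) +
          n * ((Real.pi ^ 2 / (4 * s ^ 2) : ℝ) - (c * v : ℝ) * Complex.I) := by
      rw [hc, hnC]; push_cast; field_simp; ring
    rw [circleKernel, e1, e2, Complex.exp_add, ← Complex.ofReal_exp]
    push_cast
    ring
  simp only [hpt]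
  rw [intervalIntegral.integral_const_mul, hcv, Complex.real_smul]
  have hsq : √Real.pi * √Real.pi = Real.pi := Real.mul_self_sqrt hpi.le
  have hR : Real.exp (2 * s ^ 2) / (8 * n) / √Real.pi *
      ((Real.exp (-(2 * s ^ 2)) * (4 * s / √Real.pi)) * (c⁻¹ * (2 * Real.pi))) = 1 := by
    have hee : Real.exp (2 * s ^ 2) * Real.exp (-(2 * s ^ 2)) = 1 := by
      rw [← Real.exp_add, add_neg_cancel, Real.exp_zero]
    calc _ = (Real.exp (2 * s ^ 2) * Real.exp (-(2 * s ^ 2))) * (s * Real.pi * c⁻¹) /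
          (n * (√Real.pi * √Real.pi)) := by field_simp; ring
      _ = 1 := by
        rw [hee, hsq, hc, hn]
        field_simp
  have hR' := congrArg (fun x : ℝ => (x : ℂ)) hR
  simp only [Complex.ofReal_mul, Complex.ofReal_one] at hR'
  push_cast at hR' ⊢
  linear_combination (-(overCount n : ℂ)) * hR'

/-- The asymptotic formula for the number of overpartitions. -/
lemma tendsto_overCount :
    Tendsto (fun n : ℕ => (overCount n : ℝ) /
      (Real.exp (Real.pi * √(n : ℝ)) / (8 * n))) atTop (𝓝 1) := by
  have hpi := Real.pi_pos
  have hsp : √Real.pi ≠ 0 := (Real.sqrt_pos.2 hpi).ne'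
  set σ : ℕ → ℝ := fun n => √(Real.pi * √(n : ℝ) / 2) with hσ
  have hσt : Tendsto σ atTop atTop := by
    refine Real.tendsto_sqrt_atTop.comp ?_
    refine Tendsto.atTop_div_const two_pos ?_
    exact (Real.tendsto_sqrt_atTop.comp tendsto_natCast_atTop_atTop).const_mul_atTop hpi
  have h1 := (tendsto_integral_circleKernel.comp hσt).mul_const ((√Real.pi : ℝ) : ℂ)⁻¹
  rw [mul_inv_cancel₀ (by exact_mod_cast hsp)] at h1
  have h2 : Tendsto (fun n : ℕ => ((((overCount n : ℝ) /
      (Real.exp (Real.pi * √(n : ℝ)) / (8 * n)) : ℝ)) : ℂ)) atTop (𝓝 ((1 : ℝ) : ℂ)) := by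
    rw [Complex.ofReal_one]
    refine h1.congr' ?_
    filter_upwards [eventually_gt_atTop 0] with n hn
    have hn' : (0 : ℝ) < n := by exact_mod_cast hn
    have hs2 : σ n ^ 2 = Real.pi * √(n : ℝ) / 2 := Real.sq_sqrt (by positivity)
    have hs0 : 0 < σ n := Real.sqrt_pos.2 (by positivity)
    have hn4 : (n : ℝ) = 4 * σ n ^ 4 / Real.pi ^ 2 := by
      rw [show σ n ^ 4 = (σ n ^ 2) ^ 2 by ring, hs2, div_pow, mul_pow, Real.sq_sqrt hn'.le]
      field_simp
      norm_num
    have h := overCount_eq hs0 hn4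
    rw [show 2 * σ n ^ 2 = Real.pi * √(n : ℝ) by rw [hs2]; ring] at h
    have hne : (Real.exp (Real.pi * √(n : ℝ)) / (8 * n)) ≠ 0 := by positivity
    have hneC : ((Real.exp (Real.pi * √(n : ℝ)) / (8 * n) : ℝ) : ℂ) ≠ 0 := by exact_mod_cast hne
    rw [Complex.ofReal_div (overCount n : ℝ), Complex.ofReal_natCast, h,
      Complex.ofReal_div _ (√Real.pi), Function.comp_apply, eq_div_iff hneC]
    ring
  exact (Complex.continuous_re.tendsto _).comp h2

/-! ### Asymptotics of the number of stacks -/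

lemma tendsto_growth_ratio :
    Tendsto (fun n : ℕ => (Real.exp (Real.pi * √((n + 1 : ℕ) : ℝ)) / (16 * ((n + 1 : ℕ) : ℝ))) /
      (Real.exp (Real.pi * √(n : ℝ)) / (16 * n))) atTop (𝓝 1) := by
  have h1 : Tendsto (fun n : ℕ => Real.exp (Real.pi * (√((n + 1 : ℕ) : ℝ) - √(n : ℝ)))) atTop
      (𝓝 1) := by
    have h0 : Tendsto (fun n : ℕ => √((n + 1 : ℕ) : ℝ) - √(n : ℝ)) atTop (𝓝 0) := by
      have hs : Tendsto (fun n : ℕ => (√(n : ℝ))⁻¹) atTop (𝓝 0) :=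
        (Real.tendsto_sqrt_atTop.comp tendsto_natCast_atTop_atTop).inv_tendsto_atTop
      refine squeeze_zero' (Eventually.of_forall fun n => ?_) ?_ hs
      · exact sub_nonneg.2 (Real.sqrt_le_sqrt (by push_cast; linarith))
      · filter_upwards [eventually_gt_atTop 0] with n hn
        have hn' : (0 : ℝ) < n := by exact_mod_cast hn
        have ha := Real.sqrt_pos.2 hn'
        have hb := Real.sq_sqrt hn'.le
        rw [sub_le_iff_le_add, Real.sqrt_le_iff]
        refine ⟨by positivity, ?_⟩
        push_cast
        have : ((√(n : ℝ))⁻¹ + √(n : ℝ)) ^ 2 = (√(n : ℝ))⁻¹ ^ 2 + 2 + n := by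
          rw [add_sq, hb]; field_simp
        rw [this]
        nlinarith [sq_nonneg (√(n : ℝ))⁻¹]
    simpa [Function.comp_def] using (Real.continuous_exp.tendsto _).comp (h0.const_mul Real.pi)
  have h2 : Tendsto (fun n : ℕ => (n : ℝ) / (n + 1)) atTop (𝓝 1) := tendsto_natCast_div_add_atTop 1
  have h3 := h1.mul h2
  rw [one_mul] at h3
  refine h3.congr fun n => ?_
  rw [mul_sub, Real.exp_sub]
  push_cast
  rcases Nat.eq_zero_or_pos n with rfl | hn
  · simp
  · have hn' : (0 : ℝ) < n := by exact_mod_cast hn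
    field_simp

theorem theorem1p3 :
    Asymptotics.IsEquivalent Filter.atTop
      (fun n : ℕ => (dm n : ℝ))
      (fun n : ℕ => Real.exp (Real.pi * Real.sqrt (n : ℝ)) / (16 * (n : ℝ))) := by
  set G : ℕ → ℝ := fun n => Real.exp (Real.pi * Real.sqrt (n : ℝ)) / (16 * (n : ℝ)) with hG
  have hGpos : ∀ n : ℕ, 0 < n → 0 < G n := fun n hn => by
    have : (0 : ℝ) < n := by exact_mod_cast hn
    simp only [hG]
    positivity
  -- By monotonicity, `dm n ≤ overCount n / 2 ≤ dm (n + 1)`.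
  have h1 : Tendsto (fun n => (overCount n : ℝ) / 2 / G n) atTop (𝓝 1) := by
    refine tendsto_overCount.congr fun n => ?_
    simp only [hG]
    ring
  have h2 : Tendsto (fun n => (overCount n : ℝ) / 2 / G (n + 1)) atTop (𝓝 1) := by
    have := h1.div tendsto_growth_ratio one_ne_zero
    rw [div_one] at this
    refine this.congr' ?_
    filter_upwards [eventually_gt_atTop 0] with n hn
    exact div_div_div_cancel_right₀ (hGpos n hn).ne' _ _
  refine (Asymptotics.isEquivalent_iff_tendsto_one ?_).2 ?_
  · filter_upwards [eventually_gt_atTop 0] with n hn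
    exact (hGpos n hn).ne'
  · rw [← tendsto_add_atTop_iff_nat 1]
    refine tendsto_of_tendsto_of_tendsto_of_le_of_le h2 ((tendsto_add_atTop_iff_nat 1).2 h1)
      (fun n => ?_) (fun n => ?_)
    · have := hGpos (n + 1) (by omega)
      have hm : (dm n : ℝ) ≤ dm (n + 1) := by exact_mod_cast dm_mono n
      simp only [Pi.div_apply, overCount, Nat.cast_add]
      gcongr
      linarith
    · have := hGpos (n + 1) (by omega)
      have hm : (dm (n + 1) : ℝ) ≤ dm (n + 1 + 1) := by exact_mod_cast dm_mono (n + 1)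
      simp only [Pi.div_apply, overCount, Nat.cast_add]
      gcongr
      linarith
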